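/- All groups and graphs are finite, graphs are simple. For a positive integer $d$, let $\mathcal A(d)$ be the family of pairs $(\Gamma,G)$ where $\Gamma$ is a connected graph of valency at most $d$ and $G\le\mathrm{Aut}(\Gamma)$ is transitive on the vertex set $V\Gamma$. A permutation group $G$ is quasiprimitive if each of its non-identity normal subgroups is transitive. A quasiprimitive group $G$ on a set $V$ is of type PA, with socle $N\cong T^l$, if $T$ is a non-abelian simple group, $l\ge 2$, the socle $N$ is a minimal normal subgroup of $G$, and for $\alpha\in V$ the stabiliser $N_\alpha$ is non-trivial and projects onto a proper subgroup of each of the $l$ simple direct factors of $N$. A product action structure for $G$ consists of an identification $N=T^l$, a faithful transitive action of $T$ on a set $\Delta$, and a $G$-invariant partition of $V$, identified with $\Delta^l$, such that: $G$ acts faithfully on $\Delta^l$ as a subgroup of $H\,\mathrm{wr}\,\mathrm{Sym}(l)$ in product action, where $H\le\mathrm{Sym}(\Delta)$ is, for every coordinate $i$, the group induced on the $i$-th coordinate by the elements of $G$ that fix this coordinate; $N=T^l$ acts on $\Delta^l$ coordinatewise; and, for $\alpha$ in the block $\sigma=(\sigma_1,\dots,\sigma_l)$, the group $N_\alpha$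 is a subdirect subgroup of $N_\sigma=T_{\sigma_1}\times\cdots\times T_{\sigma_l}$. For $M$ normal in $N$ and intransitive on $V\Gamma$, the normal quotient $\Gamma_M$ is the graph whose vertices are the $M$-orbits on $V\Gamma$, two distinct orbits being adjacent if and only if some edge of $\Gamma$ joins them. **Theorem.** Let $(\Gamma,G)\in\mathcal A(d)$ with $G$ quasiprimitive of type PA on $V\Gamma$, with socle $N\cong T^l$. Then $G$ admits a product action structure. For every product action structure, with $T$ acting on $\Delta$, and every $\delta\in\Delta$, $$l\le d^d\,|T_\delta|^{2d}.$$ Moreover, $(\Gamma,G)$ uniquely determines, up to isomorphism, a pair $(\Lambda,T)\in\mathcal A(d)$ whose vertex stabilisers are conjugate to $T_\delta$, namely the normal quotient of $\Gamma$ modulo a maximal normal subgroup of $N$. That is: $N$ has a maximal normal subgroup; each maximal normal subgroup $M$ of $N$ is intransitive on $V\Gamma$, and $N/M$ acts faithfully on the set of $M$-orbits, with $(\Gamma_M,N/M)\in\mathcal A(d)$; for every product action structure, some coordinate projection $N=T^l\to T$ induces an isomorphism $N/M\cong T$ that maps the stabiliser in $N/M$ of each vertex of $\Gamma_M$ to a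 conjugate in $T$ of $T_\delta$, for each $\delta\in\Delta$; and for any two maximal normal subgroups $M,M'$ of $N$ the pairs $(\Gamma_M,N/M)$ and $(\Gamma_{M'},N/M')$ are isomorphic, by a graph isomorphism compatible with a group isomorphism. -/

import Mathlib

universe u v w x

section PermutationGroups

/-- Minimal normal subgroups: minimal among the nontrivial normal subgroups. -/
def IsMinimalNormal {G : Type*} [Group G] (N : Subgroup G) : Prop :=
  N.Normal ∧ N ≠ ⊥ ∧ ∀ K : Subgroup G, K.Normal → K ≤ N → K = ⊥ ∨ K = N

/-- Maximal normal subgroups: maximal among the proper normal subgroups. -/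
def IsMaximalNormal {G : Type*} [Group G] (M : Subgroup G) : Prop :=
  M.Normal ∧ M ≠ ⊤ ∧ ∀ K : Subgroup G, K.Normal → M ≤ K → K = M ∨ K = ⊤

/-- The socle: the subgroup generated by all minimal normal subgroups. -/
def socle (G : Type*) [Group G] : Subgroup G :=
  sSup {N : Subgroup G | IsMinimalNormal N}

/-- The action of `N ⧸ M` on the set of `M`-orbits, for `M` normal in `N`:
`(n M) • (orbit of v) = orbit of n • v`. -/
instance orbitQuotientAction {N V : Type*} [Group N] [MulAction N V] (M : Subgroup N)
    [hM : M.Normal] : MulAction (N ⧸ M) (MulAction.orbitRel.Quotient M V) where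
  smul := Quotient.map₂ (fun (n : N) (v : V) => n • v) (by
    intro a b hab v w hvw
    have hab' : a⁻¹ * b ∈ M := QuotientGroup.leftRel_apply.mp hab
    obtain ⟨m, rfl⟩ := hvw
    have h1 : a * (m : N) * a⁻¹ ∈ M := hM.conj_mem _ m.2 a
    have h2 : a * (a⁻¹ * b)⁻¹ * a⁻¹ ∈ M := hM.conj_mem _ (M.inv_mem hab') a
    refine ⟨⟨_, M.mul_mem h1 h2⟩, ?_⟩
    change (a * (m : N) * a⁻¹ * (a * (a⁻¹ * b)⁻¹ * a⁻¹)) • b • w = a • (m : N) • w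
    simp only [smul_smul]
    congr 1
    group)
  one_smul := by
    rintro ⟨v⟩
    exact congrArg (Quotient.mk _) (one_smul N v)
  mul_smul := by
    rintro ⟨a⟩ ⟨b⟩ ⟨v⟩
    exact congrArg (Quotient.mk _) (mul_smul a b v)

end PermutationGroups

section Families

/-- `(Γ, G) ∈ 𝒜(d)`: `Γ` is a connected graph of valency at most `d`, and `G` is (through a
faithful action) a vertex-transitive group of automorphisms of `Γ`. -/
structure InFamily (d : ℕ) {V : Type*} (Γ : SimpleGraph V) (G : Type*) [Group G]
    [MulAction G V] : Prop where
  connected : Γ.Connected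
  valency_le : ∀ v : V, (Γ.neighborSet v).encard ≤ d
  faithful : FaithfulSMul G V
  adj_smul : ∀ (g : G) (v w : V), Γ.Adj v w → Γ.Adj (g • v) (g • w)
  transitive : MulAction.IsPretransitive G V

/-- The quotient of `Γ` modulo a group `M` acting on the vertices: its vertices are the
`M`-orbits, two distinct orbits being adjacent iff some edge of `Γ` joins them. -/
def normalQuotient {V : Type*} (Γ : SimpleGraph V) (M : Type*) [Group M] [MulAction M V] :
    SimpleGraph (MulAction.orbitRel.Quotient M V) where
  Adj p q := p ≠ q ∧ ∃ a b : V, Γ.Adj a b ∧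
    (Quotient.mk (MulAction.orbitRel M V) a) = p ∧ (Quotient.mk (MulAction.orbitRel M V) b) = q
  symm := ⟨by
    rintro p q ⟨hne, a, b, hab, ha, hb⟩
    exact ⟨hne.symm, b, a, hab.symm, hb, ha⟩⟩
  loopless := ⟨fun _ h => h.1 rfl⟩

/-- Isomorphism of pairs (graph, group acting on it). -/
def PairIso {V W : Type*} (Γ : SimpleGraph V) (G : Type*) [Group G] [MulAction G V]
    (Λ : SimpleGraph W) (H : Type*) [Group H] [MulAction H W] : Prop :=
  ∃ (f : Γ ≃g Λ) (θ : G ≃* H), ∀ (g : G) (v : V), f (g • v) = θ g • f v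

end Families

section TypePA

/-- The `i`-th coordinate projection `N → T` of a group identified with `T ^ l`. -/
def coordHom {N T : Type*} [Group N] [Group T] {l : ℕ} (e : N ≃* (Fin l → T)) (i : Fin l) :
    N →* T :=
  (Pi.evalMonoidHom (fun _ : Fin l => T) i).comp e.toMonoidHom

/-- `G` is a quasiprimitive group of type PA on `V` with socle `N ≅ T ^ l`: the action is
faithful and quasiprimitive, `N` is minimal normal in `G`, `T` is a nonabelian simple group,
`l ≥ 2`, the stabilisers `N_α` are nontrivial, and `N_α` projects to a proper subgroup of each
of the `l` simple direct factors of `N`. -/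
structure IsTypePA (G : Type u) [Group G] (V : Type v) [MulAction G V]
    (T : Type w) [Group T] (l : ℕ) : Prop where
  faithful : FaithfulSMul G V
  quasiprimitive : MulAction.IsQuasiPreprimitive G V
  minimal : IsMinimalNormal (socle G)
  simple : IsSimpleGroup T
  nonabelian : ∃ a b : T, a * b ≠ b * a
  two_le : 2 ≤ l
  stabilizer_ne_bot : ∀ α : V, MulAction.stabilizer (socle G) α ≠ ⊥
  proj_ne_top : ∃ e : socle G ≃* (Fin l → T), ∀ (α : V) (i : Fin l),
    (MulAction.stabilizer (socle G) α).map (coordHom e i) ≠ ⊤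

/-- The wreath product `H wr Sym(l)`, for `H ≤ Sym(Δ)`, in product action on `Δ ^ l`: the
permutations of `Δ ^ l` that permute the coordinates by some `τ` and apply elements of `H`
to them. -/
def wreathProductAction {Δ : Type*} (H : Subgroup (Equiv.Perm Δ)) (l : ℕ) :
    Subgroup (Equiv.Perm (Fin l → Δ)) where
  carrier := {f | ∃ (τ : Equiv.Perm (Fin l)) (h : Fin l → Equiv.Perm Δ),
    (∀ i, h i ∈ H) ∧ ∀ (a : Fin l → Δ) (i : Fin l), f a (τ i) = h i (a i)}
  one_mem' := ⟨1, fun _ => 1, fun _ => H.one_mem, fun _ _ => rfl⟩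
  mul_mem' := by
    rintro f g ⟨τ, h, hH, hf⟩ ⟨τ', h', hH', hg⟩
    refine ⟨τ * τ', fun i => h (τ' i) * h' i, fun i => H.mul_mem (hH _) (hH' _), fun a i => ?_⟩
    simp [hf, hg]
  inv_mem' := by
    rintro f ⟨τ, h, hH, hf⟩
    refine ⟨τ⁻¹, fun i => (h (τ⁻¹ i))⁻¹, fun i => H.inv_mem (hH _), fun a i => ?_⟩
    have h1 := hf (f⁻¹ a) (τ⁻¹ i)
    have h2 : f (f⁻¹ a) = a := f.apply_symm_apply a
    have h3 : τ (τ⁻¹ i) = i := τ.apply_symm_apply i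
    rw [h2, h3] at h1
    rw [h1]
    exact ((h (τ⁻¹ i)).symm_apply_apply _).symm

/-- A product action structure for `G` on `V` with socle `N ≅ T ^ l`.

The nonempty fibres of `block` form a `G`-invariant partition `Σ` of `V`, identified with
`Δ ^ l`; the action `ρ` of `G` on `Σ = Δ ^ l` is faithful and contained in `H wr Sym(l)` in
product action, where `H ≤ Sym(Δ)` is the group induced on each coordinate `i` by the elements
of `G` that fix that coordinate (the normaliser in `G` of the `i`-th simple factor of `N`).
The socle `N` acts on `Δ ^ l` as `T ^ l`, with `T` a transitive subgroup of `Sym(Δ)`, and for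
`α` in the block `σ = (σ_1, …, σ_l)` the group `N_α` is a subdirect subgroup of
`N_σ = T_{σ_1} × ⋯ × T_{σ_l}`; in particular `N_α` is subdirect in `T_δ ^ l`
if `σ = (δ, …, δ)`. -/
structure ProductActionStructure (G : Type u) [Group G] (V : Type v) [MulAction G V]
    (T : Type w) [Group T] (l : ℕ) (Δ : Type x) [MulAction T Δ] where
  /-- the identification of the socle with `T ^ l` -/
  e : socle G ≃* (Fin l → T)
  /-- the block containing a vertex -/
  block : V → (Fin l → Δ)
  block_surjective : Function.Surjective block
  /-- the action on the blocks -/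
  ρ : G →* Equiv.Perm (Fin l → Δ)
  ρ_injective : Function.Injective ρ
  block_smul : ∀ (g : G) (α : V), block (g • α) = ρ g (block α)
  /-- the component of the wreath product -/
  H : Subgroup (Equiv.Perm Δ)
  ρ_mem : ∀ g : G, ρ g ∈ wreathProductAction H l
  mem_H_iff : ∀ (i : Fin l) (h : Equiv.Perm Δ),
    h ∈ H ↔ ∃ g : G, ∀ a : Fin l → Δ, ρ g a i = h (a i)
  faithful : FaithfulSMul T Δ
  transitive : MulAction.IsPretransitive T Δ
  socle_smul : ∀ (n : socle G) (a : Fin l → Δ) (i : Fin l), ρ (n : G) a i = e n i • a i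
  subdirect : ∀ (α : V) (i : Fin l),
    (MulAction.stabilizer (socle G) α).map (coordHom e i)
      = MulAction.stabilizer T (block α i)

end TypePA

/-! ### Normal subgroups of direct powers of a nonabelian simple group -/

section DirectPowers

/-! The maximal normal subgroups of N = T^l are exactly the kernels of the l coordinate projections
(`IsMaximalNormal.exists_eq_ker`, `isMaximalNormal_ker`). Minimality of N in G makes G permute them
transitively by conjugation (`IsMinimalNormal.exists_comap_conjNormal_eq`), so all normal quotients
Γ_M are isomorphic. Such an M is intransitive: otherwise N = M N_α and N_α would project onto T.

For a product action structure, fix one kernel M, let Δ be the set of M-orbits, and choose γ_i in G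
conjugating the i-th kernel to M. The i-th coordinate of the block of v is the M-orbit of γ_i v.

For the bound (`IsTypePA.le_card_stabilizer`), take α in a diagonal block (δ, …, δ). Transitivity of
N lets the conjugating elements k_i be chosen in G_α. Fix n_β in N with n_β α = β. Coordinate i is
encoded by the map that k_i induces on the neighbourhood of α, together with one element of T_δ per
neighbour β, comparing n_β with n_{k_i β}. If i and j have the same code, two homomorphisms N → T
agree on every n_β. By connectedness their equaliser is transitive on vertices, so the i-th and j-th
coordinate maps V → Δ coincide, which forces i = j. Counting codes gives d^d |T_δ|^d. -/

/-- A proper normal subgroup of a direct power of a nonabelian simple group is contained in the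
kernel of a coordinate projection. -/
theorem exists_le_ker_eval {ι T : Type*} [Finite ι] [DecidableEq ι] [Group T] [IsSimpleGroup T]
    (hT : ∃ a b : T, a * b ≠ b * a) (K : Subgroup (ι → T)) [hK : K.Normal] (hne : K ≠ ⊤) :
    ∃ i, ∀ k ∈ K, k i = 1 := by
  by_contra! hcon
  apply hne
  have key : ∀ i (t : T), Pi.mulSingle i t ∈ K := by
    intro i
    obtain ⟨k, hk, hki⟩ := hcon i
    have hL : (K.comap (MonoidHom.mulSingle (fun _ : ι => T) i)).Normal := inferInstance
    rcases hL.eq_bot_or_eq_top with h | h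
    · exfalso
      have hcomm : ∀ x : T, k i * x = x * k i := by
        intro x
        have hmem : k i * x * (k i)⁻¹ * x⁻¹ ∈ K.comap (MonoidHom.mulSingle (fun _ : ι => T) i) := by
          rw [Subgroup.mem_comap]
          -- The commutator of k with an element of the i-th factor lies in K and is supported at i.
          -- If K meets that factor trivially, k i is therefore central in T.
          have h1 : k * (Pi.mulSingle i x * k⁻¹ * (Pi.mulSingle i x)⁻¹) ∈ K :=
            K.mul_mem hk (hK.conj_mem _ (K.inv_mem hk) _)
          convert h1 using 1
          funext j
          by_cases hj : j = i
          · subst hj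
            simp [mul_assoc]
          · simp [hj]
        rw [h, Subgroup.mem_bot] at hmem
        rwa [mul_inv_eq_one, mul_inv_eq_iff_eq_mul] at hmem
      have hc : k i ∈ Subgroup.center T := Subgroup.mem_center_iff.2 fun x => (hcomm x).symm
      rcases (inferInstance : (Subgroup.center T).Normal).eq_bot_or_eq_top with h' | h'
      · rw [h', Subgroup.mem_bot] at hc
        exact hki hc
      · obtain ⟨a, b, hab⟩ := hT
        have ha : b ∈ Subgroup.center T := h' ▸ Subgroup.mem_top b
        exact hab (Subgroup.mem_center_iff.1 ha a)
    · intro t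
      have : t ∈ K.comap (MonoidHom.mulSingle (fun _ : ι => T) i) := h ▸ Subgroup.mem_top t
      exact this
  rw [Subgroup.eq_top_iff']
  intro x
  exact Subgroup.pi_mem_of_mulSingle_mem x fun i => key i (x i)

variable {N T : Type*} [Group N] [Group T] {l : ℕ}

theorem coordHom_apply (e : N ≃* (Fin l → T)) (i : Fin l) (n : N) : coordHom e i n = e n i := rfl

theorem mem_ker_coordHom {e : N ≃* (Fin l → T)} {i : Fin l} {n : N} :
    n ∈ (coordHom e i).ker ↔ e n i = 1 := Iff.rfl

theorem coordHom_surjective (e : N ≃* (Fin l → T)) (i : Fin l) :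
    Function.Surjective (coordHom e i) := fun t =>
  ⟨e.symm fun _ => t, by simp [coordHom_apply]⟩

/-- M lies in some coordinate kernel, which is proper, so maximality forces equality. Coordinates
thus become objects on which automorphisms of N act. -/
theorem IsMaximalNormal.exists_eq_ker [IsSimpleGroup T] (hT : ∃ a b : T, a * b ≠ b * a)
    (e : N ≃* (Fin l → T)) {M : Subgroup N} (hM : IsMaximalNormal M) :
    ∃ i, M = (coordHom e i).ker := by
  have hn := hM.1
  have hn' : (M.map e.toMonoidHom).Normal := hn.map _ e.surjective
  have hne : M.map e.toMonoidHom ≠ ⊤ := by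
    intro h
    apply hM.2.1
    rw [Subgroup.eq_top_iff']
    intro n
    have : e n ∈ M.map e.toMonoidHom := h ▸ Subgroup.mem_top _
    obtain ⟨m, hm, hmn⟩ := this
    rwa [← e.injective hmn]
  obtain ⟨i, hi⟩ := exists_le_ker_eval hT _ hne
  refine ⟨i, ?_⟩
  rcases hM.2.2 (coordHom e i).ker inferInstance
    (fun m hm => hi _ (Subgroup.mem_map_of_mem _ hm)) with h | h
  · exact h.symm
  · exfalso
    obtain ⟨t, ht⟩ := exists_ne (1 : T)
    obtain ⟨n, hn⟩ := coordHom_surjective e i t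
    have : n ∈ (coordHom e i).ker := h ▸ Subgroup.mem_top n
    exact ht (hn ▸ this)

theorem isMaximalNormal_ker [IsSimpleGroup T] (e : N ≃* (Fin l → T)) (i : Fin l) :
    IsMaximalNormal (coordHom e i).ker := by
  have hs := coordHom_surjective e i
  refine ⟨inferInstance, fun h => ?_, fun K hK hle => ?_⟩
  · obtain ⟨t, ht⟩ := exists_ne (1 : T)
    obtain ⟨n, hn⟩ := hs t
    have : n ∈ (coordHom e i).ker := h ▸ Subgroup.mem_top n
    exact ht (hn ▸ this)
  · have hcm : (K.map (coordHom e i)).comap (coordHom e i) = K := Subgroup.comap_map_eq_self hle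
    rcases (hK.map _ hs).eq_bot_or_eq_top with h | h
    · left
      rw [← hcm, h]
      rfl
    · right
      rw [← hcm, h, Subgroup.comap_top]

theorem ker_coordHom_injective [Nontrivial T] (e : N ≃* (Fin l → T)) :
    Function.Injective fun i => (coordHom e i).ker := by
  intro i j hij
  by_contra hne
  obtain ⟨t, ht⟩ := exists_ne (1 : T)
  have h1 : e.symm (Pi.mulSingle i t) ∈ (coordHom e j).ker := by
    rw [mem_ker_coordHom, MulEquiv.apply_symm_apply, Pi.mulSingle_eq_of_ne (Ne.symm hne)]
  have h2 : e.symm (Pi.mulSingle i t) ∈ (coordHom e i).ker := by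
    simp only at hij
    rwa [hij]
  rw [mem_ker_coordHom, MulEquiv.apply_symm_apply, Pi.mulSingle_eq_same] at h2
  exact ht h2

theorem IsMaximalNormal.comap_equiv {M : Subgroup N} (hM : IsMaximalNormal M) (c : N ≃* N) :
    IsMaximalNormal (M.comap c.toMonoidHom) := by
  have hn := hM.1
  refine ⟨inferInstance, fun h => hM.2.1 ?_, fun K hK hle => ?_⟩
  · exact Subgroup.comap_injective (f := c.toMonoidHom) c.surjective (by rw [h, Subgroup.comap_top])
  · have hK' : K = (K.map c.toMonoidHom).comap c.toMonoidHom :=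
      (Subgroup.comap_map_eq_self_of_injective c.injective K).symm
    have hle' : M ≤ K.map c.toMonoidHom := by
      rw [hK'] at hle
      exact (Subgroup.comap_le_comap_of_surjective c.surjective).1 hle
    rcases hM.2.2 _ (hK.map _ c.surjective) hle' with h | h
    · left
      rw [hK', h]
    · right
      rw [hK', h, Subgroup.comap_top]

/-- A group containing a minimal normal subgroup isomorphic to `T ^ l` permutes transitively,
by conjugation, the maximal normal subgroups of that subgroup. -/
theorem IsMinimalNormal.exists_comap_conjNormal_eq {G : Type*} [Group G] {N : Subgroup G}
    [N.Normal] (hN : IsMinimalNormal N) [IsSimpleGroup T] (hT : ∃ a b : T, a * b ≠ b * a)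
    (e : N ≃* (Fin l → T)) {M M' : Subgroup N} (hM : IsMaximalNormal M)
    (hM' : IsMaximalNormal M') :
    ∃ g : G, M.comap (MulAut.conjNormal g : N ≃* N).toMonoidHom = M' := by
  by_contra! hcon
  -- L is the largest subgroup of M normal in G. If no conjugate of M were M' = ker of coordinate i,
  -- every conjugate would contain the i-th factor, so L ≠ 1. Minimality then gives L = N, against M
  -- ≠ N.
  let L : Subgroup N := ⨅ g : G, M.comap (MulAut.conjNormal g : N ≃* N).toMonoidHom
  have memL : ∀ n : N, n ∈ L ↔ ∀ g : G, MulAut.conjNormal g n ∈ M := fun n => by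
    simp [L, Subgroup.mem_iInf]
  have hLn : (L.map N.subtype).Normal := by
    refine ⟨?_⟩
    rintro _ ⟨n, hn, rfl⟩ g
    refine ⟨MulAut.conjNormal g n, (memL _).2 fun g' => ?_, MulAut.conjNormal_apply g n⟩
    have := (memL n).1 hn (g' * g)
    rwa [map_mul] at this
  rcases hN.2.2 _ hLn (Subgroup.map_subtype_le L) with h | h
  · have hL : L = ⊥ := (Subgroup.map_eq_bot_iff_of_injective _ N.subtype_injective).1 h
    obtain ⟨i, rfl⟩ := hM'.exists_eq_ker hT e
    obtain ⟨t, ht⟩ := exists_ne (1 : T)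
    have hmem : e.symm (Pi.mulSingle i t) ∈ L := by
      refine Subgroup.mem_iInf.2 fun g => ?_
      obtain ⟨j, hj⟩ := (hM.comap_equiv (MulAut.conjNormal g : N ≃* N)).exists_eq_ker hT e
      have hji : j ≠ i := by
        rintro rfl
        exact hcon g hj
      rw [hj, mem_ker_coordHom, MulEquiv.apply_symm_apply, Pi.mulSingle_eq_of_ne hji]
    rw [hL, Subgroup.mem_bot, map_eq_one_iff _ e.symm.injective, Pi.mulSingle_eq_one_iff] at hmem
    exact ht hmem
  · apply hM.2.1
    rw [Subgroup.eq_top_iff']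
    intro n
    have : (n : G) ∈ L.map N.subtype := h.symm.le n.2
    obtain ⟨n', hn', hnn⟩ := this
    have : n' = n := Subtype.ext hnn
    subst this
    simpa using (memL n').1 hn' 1

end DirectPowers

/-! ### Orbits of normal subgroups and normal quotient graphs -/

section OrbitQuotients

open MulAction

theorem orbitMk_eq_iff {N V : Type*} [Group N] [MulAction N V] {M : Subgroup N} {v w : V} :
    Quotient.mk (orbitRel M V) v = Quotient.mk (orbitRel M V) w ↔ ∃ m ∈ M, m • w = v := by
  rw [Quotient.eq]
  exact ⟨fun ⟨m, hm⟩ => ⟨m, m.2, hm⟩, fun ⟨m, hm, h⟩ => ⟨⟨m, hm⟩, h⟩⟩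

theorem orbitMk_smul {N V : Type*} [Group N] [MulAction N V] (M : Subgroup N) [M.Normal]
    (n : N) (v : V) : (QuotientGroup.mk n : N ⧸ M) • Quotient.mk (orbitRel M V) v
      = Quotient.mk (orbitRel M V) (n • v) := rfl

variable {G V : Type*} [Group G] [MulAction G V] {N : Subgroup G} [N.Normal]

theorem conjNormal_smul_smul (g : G) (n : N) (v : V) :
    (MulAut.conjNormal g n) • g • v = g • n • v := by
  simp only [Subgroup.smul_def, MulAut.conjNormal_apply, smul_smul]
  congr 1
  group

theorem conjNormal_inv_apply_apply (g : G) (n : N) :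
    MulAut.conjNormal g (MulAut.conjNormal g⁻¹ n) = n := by
  ext
  simp

theorem orbitMk_smul_eq_iff {M M' : Subgroup N} {g : G}
    (hg : M'.comap (MulAut.conjNormal g : N ≃* N).toMonoidHom = M) {v w : V} :
    Quotient.mk (orbitRel M' V) (g • v) = Quotient.mk (orbitRel M' V) (g • w) ↔
      Quotient.mk (orbitRel M V) v = Quotient.mk (orbitRel M V) w := by
  rw [orbitMk_eq_iff, orbitMk_eq_iff]
  subst hg
  constructor
  · rintro ⟨m, hm, h⟩
    refine ⟨MulAut.conjNormal g⁻¹ m, ?_, ?_⟩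
    · change MulAut.conjNormal g (MulAut.conjNormal g⁻¹ m) ∈ M'
      rwa [conjNormal_inv_apply_apply]
    · apply smul_left_cancel g
      rw [← conjNormal_smul_smul, conjNormal_inv_apply_apply, h]
  · rintro ⟨m, hm, h⟩
    exact ⟨MulAut.conjNormal g m, hm, by rw [conjNormal_smul_smul, h]⟩

/-- If `g` conjugates `M` to `M'`, then `v ↦ g • v` induces a bijection from the `M`-orbits
to the `M'`-orbits. -/
noncomputable def orbitQuotientEquiv {M M' : Subgroup N} (g : G)
    (hg : M'.comap (MulAut.conjNormal g : N ≃* N).toMonoidHom = M) :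
    orbitRel.Quotient M V ≃ orbitRel.Quotient M' V :=
  Equiv.ofBijective
    (Quotient.map' (fun v => g • v) fun _ _ h =>
      Quotient.exact ((orbitMk_smul_eq_iff hg).2 (Quotient.sound h)))
    ⟨by
      rintro ⟨v⟩ ⟨w⟩ h
      exact (orbitMk_smul_eq_iff hg).1 h, by
      rintro ⟨v⟩
      exact ⟨Quotient.mk _ (g⁻¹ • v), congrArg (Quotient.mk _) (smul_inv_smul g v)⟩⟩

theorem orbitQuotientEquiv_mk {M M' : Subgroup N} (g : G)
    (hg : M'.comap (MulAut.conjNormal g : N ≃* N).toMonoidHom = M) (v : V) :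
    orbitQuotientEquiv g hg (Quotient.mk (orbitRel M V) v)
      = Quotient.mk (orbitRel M' V) (g • v) := rfl

/-- Conjugate normal subgroups have isomorphic normal quotients. -/
theorem pairIso_of_comap_conjNormal_eq {Γ : SimpleGraph V}
    (hΓ : ∀ (g : G) (v w : V), Γ.Adj v w → Γ.Adj (g • v) (g • w)) {M M' : Subgroup N} [M.Normal]
    [M'.Normal] (g : G) (hg : M'.comap (MulAut.conjNormal g : N ≃* N).toMonoidHom = M) :
    PairIso (normalQuotient Γ M) (N ⧸ M) (normalQuotient Γ M') (N ⧸ M') := by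
  let f := orbitQuotientEquiv (V := V) g hg
  have hmap : M.map (MulAut.conjNormal g : N ≃* N).toMonoidHom = M' := by
    rw [← hg]
    exact Subgroup.map_comap_eq_self_of_surjective (MulAut.conjNormal g : N ≃* N).surjective M'
  refine ⟨⟨f, ?_⟩, QuotientGroup.congr M M' (MulAut.conjNormal g : N ≃* N) hmap, ?_⟩
  · intro p q
    constructor
    · rintro ⟨hne, a, b, hab, ha, hb⟩
      refine ⟨fun h => hne (congrArg f h), g⁻¹ • a, g⁻¹ • b, hΓ _ _ _ hab, ?_, ?_⟩
      · apply f.injective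
        rw [← ha, orbitQuotientEquiv_mk, smul_inv_smul]
      · apply f.injective
        rw [← hb, orbitQuotientEquiv_mk, smul_inv_smul]
    · rintro ⟨hne, a, b, hab, rfl, rfl⟩
      exact ⟨fun h => hne (f.injective h), g • a, g • b, hΓ _ _ _ hab, rfl, rfl⟩
  · rintro ⟨n⟩ ⟨v⟩
    exact congrArg (Quotient.mk _) (conjNormal_smul_smul g n v).symm

/-- The normal quotient of a graph in the family belongs to the family, as soon as the quotient
group acts faithfully. -/
theorem inFamily_normalQuotient {d : ℕ} {V N : Type*} [Group N] [MulAction N V]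
    [IsPretransitive N V] {Γ : SimpleGraph V} (hconn : Γ.Connected)
    (hval : ∀ v : V, (Γ.neighborSet v).encard ≤ d)
    (hadj : ∀ (n : N) (v w : V), Γ.Adj v w → Γ.Adj (n • v) (n • w)) (M : Subgroup N) [M.Normal]
    (hfaith : FaithfulSMul (N ⧸ M) (orbitRel.Quotient M V)) :
    InFamily d (normalQuotient Γ M) (N ⧸ M) where
  connected := by
    have hne := hconn.nonempty
    have : Nonempty (orbitRel.Quotient M V) := hne.map (Quotient.mk _)
    refine ⟨?_⟩
    rintro ⟨v⟩ ⟨w⟩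
    obtain ⟨p⟩ := hconn.preconnected v w
    induction p with
    | nil => exact SimpleGraph.Reachable.refl _
    | @cons a b c hab _ ih =>
      refine SimpleGraph.Reachable.trans ?_ ih
      by_cases h : (Quotient.mk (orbitRel M V) a) = Quotient.mk (orbitRel M V) b
      · change (normalQuotient Γ M).Reachable (Quotient.mk (orbitRel M V) a)
          (Quotient.mk (orbitRel M V) b)
        rw [h]
      · exact SimpleGraph.Adj.reachable ⟨h, a, b, hab, rfl, rfl⟩
  valency_le := by
    rintro ⟨v⟩
    refine le_trans (Set.encard_le_encard ?_)
      ((Set.encard_image_le (Quotient.mk (orbitRel M V)) (Γ.neighborSet v)).trans (hval v))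
    rintro q ⟨-, a, b, hab, ha, rfl⟩
    -- Translating the edge by an element of M makes it start at v, so every neighbour of the orbit
    -- of v is the orbit of a neighbour of v.
    obtain ⟨m, hm, rfl⟩ := orbitMk_eq_iff.1 ha
    refine ⟨m⁻¹ • b, ?_, orbitMk_eq_iff.2 ⟨m⁻¹, M.inv_mem hm, rfl⟩⟩
    have := hadj m⁻¹ _ _ hab
    rwa [inv_smul_smul] at this
  faithful := hfaith
  adj_smul := by
    rintro ⟨n⟩ p q ⟨hne, a, b, hab, rfl, rfl⟩
    exact ⟨fun h => hne (smul_left_cancel _ h), n • a, n • b, hadj _ _ _ hab, rfl, rfl⟩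
  transitive := by
    refine ⟨?_⟩
    rintro ⟨v⟩ ⟨w⟩
    obtain ⟨n, rfl⟩ := exists_smul_eq N v w
    exact ⟨QuotientGroup.mk n, rfl⟩

/-- A maximal normal subgroup that is intransitive is the kernel of the action on its orbits. -/
theorem IsMaximalNormal.faithfulSMul_orbits {V N : Type*} [Group N] [MulAction N V]
    [IsPretransitive N V] {M : Subgroup N} [M.Normal] (hM : IsMaximalNormal M)
    (hintrans : ¬ IsPretransitive M V) : FaithfulSMul (N ⧸ M) (orbitRel.Quotient M V) := by
  suffices hker : (toPermHom (N ⧸ M) (orbitRel.Quotient M V)).ker = ⊥ from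
    ⟨fun hab => (MonoidHom.ker_eq_bot_iff _).1 hker (Equiv.ext hab)⟩
  let K : Subgroup N := ((toPermHom (N ⧸ M) (orbitRel.Quotient M V)).comp (QuotientGroup.mk' M)).ker
  have hK : ∀ n ∈ K, ∀ v : V,
      Quotient.mk (orbitRel M V) (n • v) = Quotient.mk (orbitRel M V) v := fun n hn v =>
    Equiv.ext_iff.1 (show toPermHom (N ⧸ M) (orbitRel.Quotient M V) (QuotientGroup.mk n) = 1 from hn)
      (Quotient.mk (orbitRel M V) v)
  have hMK : M ≤ K := fun m hm => by
    change toPermHom (N ⧸ M) (orbitRel.Quotient M V) (QuotientGroup.mk m) = 1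
    rw [(QuotientGroup.eq_one_iff m).2 hm, map_one]
  -- If K were all of N, each M-orbit would be N-invariant, and transitivity of N would pass to M.
  rcases hM.2.2 K inferInstance hMK with h | h
  · rw [Subgroup.eq_bot_iff_forall]
    rintro ⟨n⟩ hn
    have : n ∈ K := hn
    rw [h] at this
    exact (QuotientGroup.eq_one_iff n).2 this
  · exfalso
    apply hintrans
    refine ⟨fun v w => ?_⟩
    obtain ⟨n, rfl⟩ := exists_smul_eq N v w
    obtain ⟨m, hm, h'⟩ := orbitMk_eq_iff.1 (hK n (h ▸ Subgroup.mem_top n) v)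
    exact ⟨⟨m, hm⟩, h'⟩

/-- The stabiliser of the orbit of v is M N_v / M, so a projection with kernel M gives it the same
image as N_v. -/
theorem mem_stabilizer_orbitMk {V N : Type*} [Group N] [MulAction N V] {M : Subgroup N}
    [M.Normal] {n : N} {v : V} :
    (QuotientGroup.mk n : N ⧸ M) ∈ stabilizer (N ⧸ M) (Quotient.mk (orbitRel M V) v) ↔
      ∃ m ∈ M, m * n ∈ stabilizer N v := by
  rw [mem_stabilizer_iff, orbitMk_smul, eq_comm, orbitMk_eq_iff]
  simp only [mem_stabilizer_iff, smul_smul]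

end OrbitQuotients

/-! ### Consequences of type PA -/

section TypePA

open MulAction

variable {G : Type u} [Group G] {V : Type v} [MulAction G V] {T : Type w} [Group T] {l : ℕ}

theorem IsTypePA.isPretransitive_socle (h : IsTypePA G V T l) : IsPretransitive (socle G) V := by
  have := h.minimal.1
  have := h.faithful
  refine h.quasiprimitive.isPretransitive_of_normal fun hfix => h.minimal.2.1 ?_
  rw [Subgroup.eq_bot_iff_forall]
  intro n hn
  refine FaithfulSMul.eq_of_smul_eq_smul (α := V) fun v => ?_
  have : v ∈ fixedPoints (socle G) V := hfix ▸ Set.mem_univ v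
  rw [one_smul]
  exact this ⟨n, hn⟩

/-- A transitive coordinate kernel M would give N = M N_α, so N_α would project onto T in that
coordinate. -/
theorem IsTypePA.not_isPretransitive [Nonempty V] (h : IsTypePA G V T l)
    {M : Subgroup (socle G)} (hM : IsMaximalNormal M) : ¬ IsPretransitive M V := by
  intro htrans
  have := h.simple
  obtain ⟨e, he⟩ := h.proj_ne_top
  obtain ⟨i, rfl⟩ := hM.exists_eq_ker h.nonabelian e
  obtain ⟨α⟩ := ‹Nonempty V›
  apply he α i
  rw [Subgroup.eq_top_iff']
  intro t
  obtain ⟨n, rfl⟩ := coordHom_surjective e i t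
  obtain ⟨m, hm⟩ := exists_smul_eq (coordHom e i).ker (n • α) α
  refine ⟨m * n, ?_, ?_⟩
  · rw [Subgroup.smul_def, smul_smul] at hm
    exact hm
  · rw [map_mul, show coordHom e i m = 1 from m.2, one_mul]

/-- A coordinate projection maps the vertex stabilisers of the corresponding normal quotient to
point stabilisers of `T` on `Δ`. -/
theorem ProductActionStructure.exists_quotient_equiv {Δ : Type x} [MulAction T Δ]
    (D : ProductActionStructure G V T l Δ) (M : Subgroup (socle G)) [M.Normal] (i : Fin l)
    (hM : M = (coordHom D.e i).ker) :
    ∃ φ : (socle G ⧸ M) ≃* T, (∀ n : socle G, φ (QuotientGroup.mk n) = D.e n i) ∧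
      ∀ (δ : Δ) (p : orbitRel.Quotient M V), ∃ t : T,
        (stabilizer (socle G ⧸ M) p).map φ.toMonoidHom
          = (stabilizer T δ).map (MulAut.conj t).toMonoidHom := by
  subst hM
  have hφ : ∀ n : socle G, QuotientGroup.quotientKerEquivOfSurjective (coordHom D.e i)
    (coordHom_surjective D.e i) (QuotientGroup.mk n) = D.e n i := fun _ => rfl
  refine ⟨_, hφ, ?_⟩
  rintro δ ⟨v⟩
  have := D.transitive
  obtain ⟨t, ht⟩ := exists_smul_eq T δ (D.block v i)
  refine ⟨t, ?_⟩
  rw [← stabilizer_smul_eq_stabilizer_map_conj, ht, ← D.subdirect v i]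
  ext s
  constructor
  · rintro ⟨⟨n⟩, hn, rfl⟩
    obtain ⟨m, hm, hmn⟩ := mem_stabilizer_orbitMk.1 hn
    refine ⟨m * n, hmn, ?_⟩
    rw [map_mul, show coordHom D.e i m = 1 from hm, one_mul]
    exact (hφ n).symm
  · rintro ⟨n, hn, rfl⟩
    exact ⟨QuotientGroup.mk n,
      mem_stabilizer_orbitMk.2 ⟨1, Subgroup.one_mem _, by rwa [one_mul]⟩, hφ n⟩

end TypePA

/-! ### Construction of a product action structure -/

section Existence

open MulAction

variable {G : Type v} [Group G] {V : Type u} [MulAction G V] {T : Type w} [Group T] {l : ℕ}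

/-- The group of permutations of the `M`-orbits induced by elements of `G`. -/
def inducedPerms (G : Type*) {V : Type*} [Group G] [MulAction G V] {N : Subgroup G}
    (M : Subgroup N) : Subgroup (Equiv.Perm (orbitRel.Quotient M V)) where
  carrier := {h | ∃ x : G, ∀ v : V,
    h (Quotient.mk (orbitRel M V) v) = Quotient.mk (orbitRel M V) (x • v)}
  one_mem' := ⟨1, fun v => by rw [one_smul]; rfl⟩
  mul_mem' := by
    rintro h h' ⟨x, hx⟩ ⟨y, hy⟩
    exact ⟨x * y, fun v => by rw [Equiv.Perm.mul_apply, hy, hx, mul_smul]⟩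
  inv_mem' := by
    rintro h ⟨x, hx⟩
    refine ⟨x⁻¹, fun v => ?_⟩
    rw [Equiv.Perm.inv_eq_iff_eq, hx, smul_inv_smul]

/-- Assembling a permutation of `Δ ^ l` from a permutation of the coordinates and permutations
of the components. -/
def coordPerm {ι Δ : Type*} (τ : Equiv.Perm ι) (h : ι → Equiv.Perm Δ) : Equiv.Perm (ι → Δ) :=
  (Equiv.piCongrRight h).trans (Equiv.arrowCongr τ (Equiv.refl Δ))

theorem coordPerm_apply {ι Δ : Type*} (τ : Equiv.Perm ι) (h : ι → Equiv.Perm Δ) (a : ι → Δ)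
    (i : ι) : coordPerm τ h a (τ i) = h i (a i) := by
  simp [coordPerm]

/-- `G` permutes the kernels of the coordinate projections. -/
theorem exists_perm_ker_coordHom {N : Subgroup G} [N.Normal] [IsSimpleGroup T]
    (hT : ∃ a b : T, a * b ≠ b * a) (e : N ≃* (Fin l → T)) (g : G) :
    ∃ τ : Equiv.Perm (Fin l), ∀ i,
      (coordHom e (τ i)).ker.comap (MulAut.conjNormal g : N ≃* N).toMonoidHom
        = (coordHom e i).ker := by
  -- Pulling back along conjugation by g⁻¹ is pushing forward along g, which is the direction wanted
  -- for τ.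
  have h : ∀ i, ∃ j, (coordHom e i).ker.comap (MulAut.conjNormal g⁻¹ : N ≃* N).toMonoidHom
      = (coordHom e j).ker := fun i =>
    ((isMaximalNormal_ker e i).comap_equiv _).exists_eq_ker hT e
  choose τ hτ using h
  have hτ' : ∀ i, (coordHom e (τ i)).ker.comap (MulAut.conjNormal g : N ≃* N).toMonoidHom
        = (coordHom e i).ker := by
    intro i
    rw [← hτ i]
    ext n
    have : MulAut.conjNormal g⁻¹ (MulAut.conjNormal g n) = n := by
      simp
    change MulAut.conjNormal g⁻¹ (MulAut.conjNormal g n) ∈ (coordHom e i).ker ↔ _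
    rw [this]
  have hinj : Function.Injective τ := fun i j hij =>
    ker_coordHom_injective e (by simp only; rw [← hτ' i, ← hτ' j, hij])
  exact ⟨Equiv.ofBijective τ (Finite.injective_iff_bijective.1 hinj), hτ'⟩

theorem conjNormal_mul_apply {N : Subgroup G} [N.Normal] (g h : G) (n : N) :
    MulAut.conjNormal (g * h) n = MulAut.conjNormal g (MulAut.conjNormal h n) := by
  rw [map_mul]
  rfl

theorem IsTypePA.exists_productActionStructure [Finite V] [Nonempty V] (h : IsTypePA G V T l) :
    ∃ (Δ : Type u) (_ : MulAction T Δ), Nonempty (ProductActionStructure G V T l Δ) := by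
  have := h.simple
  have := h.minimal.1
  have := h.faithful
  have := h.isPretransitive_socle
  have : Finite G := Finite.of_injective (toPermHom G V) (toPerm_injective)
  obtain ⟨e, -⟩ := h.proj_ne_top
  let i₀ : Fin l := ⟨0, by have := h.two_le; omega⟩
  let M : Subgroup (socle G) := (coordHom e i₀).ker
  have hM : IsMaximalNormal M := isMaximalNormal_ker e i₀
  have hintrans := h.not_isPretransitive hM
  let Δ : Type u := orbitRel.Quotient M V
  let cls : V → Δ := Quotient.mk (orbitRel M V)
  have cls_surj : Function.Surjective cls := Quotient.mk_surjective
  have hcls : ¬ ∀ v w : V, cls v = cls w := fun hall => hintrans ⟨fun v w => by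
    obtain ⟨m, hm, h'⟩ := orbitMk_eq_iff.1 (hall w v)
    exact ⟨⟨m, hm⟩, h'⟩⟩
  let ψ : (socle G ⧸ M) ≃* T :=
    QuotientGroup.quotientKerEquivOfSurjective (coordHom e i₀) (coordHom_surjective e i₀)
  let actT : MulAction T Δ := MulAction.compHom Δ ψ.symm.toMonoidHom
  have smul_cls : ∀ (n : socle G) (v : V), e n i₀ • cls v = cls (n • v) := by
    intro n v
    have hψ : ψ.symm (e n i₀) = QuotientGroup.mk n := by
      rw [MulEquiv.symm_apply_eq]
      rfl
    change ψ.symm (e n i₀) • cls v = _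
    rw [hψ]
    rfl
  have htrans : IsPretransitive T Δ := by
    refine ⟨?_⟩
    intro p q
    obtain ⟨v, rfl⟩ := cls_surj p
    obtain ⟨w, rfl⟩ := cls_surj q
    obtain ⟨n, rfl⟩ := exists_smul_eq (socle G) v w
    exact ⟨e n i₀, smul_cls n v⟩
  have hfaith : FaithfulSMul T Δ := by
    have := hM.faithfulSMul_orbits hintrans
    refine ⟨fun {s t} hst => ψ.symm.injective ?_⟩
    exact FaithfulSMul.eq_of_smul_eq_smul (α := Δ) hst
  have hg : ∀ i, ∃ g : G, M.comap (MulAut.conjNormal g : socle G ≃* socle G).toMonoidHom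
      = (coordHom e i).ker := fun i =>
    h.minimal.exists_comap_conjNormal_eq h.nonabelian e hM (isMaximalNormal_ker e i)
  choose γ hγ using hg
  -- The identification `e` is twisted by the γ_i so that all coordinates of N act on the same T-set
  -- Δ compatibly with `block`.
  let E : socle G →* (Fin l → T) :=
    { toFun := fun n i => e (MulAut.conjNormal (γ i) n) i₀
      map_one' := by
        funext i
        simp
      map_mul' := fun a b => by
        funext i
        simp }
  have hEinj : Function.Injective E := by
    rw [injective_iff_map_eq_one]
    intro n hn
    rw [← map_eq_one_iff e e.injective]
    funext i
    have : n ∈ M.comap (MulAut.conjNormal (γ i) : socle G ≃* socle G).toMonoidHom :=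
      congrFun hn i
    rw [hγ i] at this
    exact this
  have hEbij : Function.Bijective E := by
    have hb : Function.Bijective (e.symm ∘ E) :=
      Finite.injective_iff_bijective.1 (e.symm.injective.comp hEinj)
    exact ⟨hEinj, fun y => (hb.2 (e.symm y)).imp fun n hn => e.symm.injective hn⟩
  let e' : socle G ≃* (Fin l → T) := MulEquiv.ofBijective E hEbij
  have he' : ∀ n i, e' n i = e (MulAut.conjNormal (γ i) n) i₀ := fun _ _ => rfl
  let block : V → (Fin l → Δ) := fun v i => cls (γ i • v)
  have block_socle : ∀ (n : socle G) (v : V) (i : Fin l), block (n • v) i = e' n i • block v i := by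
    intro n v i
    rw [he', smul_cls, conjNormal_smul_smul]
  have block_surj : Function.Surjective block := by
    obtain ⟨α⟩ := ‹Nonempty V›
    intro a
    choose t ht using fun i => exists_smul_eq T (block α i) (a i)
    obtain ⟨n, rfl⟩ := e'.surjective t
    exact ⟨n • α, funext fun i => (block_socle n α i).trans (ht i)⟩
  have hρ : ∀ g : G, ∃ f : Equiv.Perm (Fin l → Δ), f ∈ wreathProductAction (inducedPerms G M) l ∧
      ∀ v, block (g • v) = f (block v) := by
    intro g
    obtain ⟨τ, hτ⟩ := exists_perm_ker_coordHom h.nonabelian e g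
    -- This element sends M to the i-th kernel, then to the τ(i)-th, then back to M. It therefore
    -- normalises M and permutes Δ.
    have hnorm : ∀ i, M.comap (MulAut.conjNormal (γ (τ i) * g * (γ i)⁻¹) :
        socle G ≃* socle G).toMonoidHom = M := by
      intro i
      ext n
      change MulAut.conjNormal (γ (τ i) * g * (γ i)⁻¹) n ∈ M ↔ n ∈ M
      rw [conjNormal_mul_apply, conjNormal_mul_apply]
      generalize hn' : MulAut.conjNormal (γ i)⁻¹ n = n'
      have hn : n = MulAut.conjNormal (γ i) n' := by
        rw [← hn', conjNormal_inv_apply_apply]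
      rw [hn]
      change MulAut.conjNormal g n' ∈ M.comap (MulAut.conjNormal (γ (τ i)) :
        socle G ≃* socle G).toMonoidHom ↔ n' ∈ M.comap (MulAut.conjNormal (γ i) :
        socle G ≃* socle G).toMonoidHom
      rw [hγ, hγ, ← hτ i]
      rfl
    let hh : Fin l → Equiv.Perm Δ := fun i => orbitQuotientEquiv (V := V) _ (hnorm i)
    have hhm : ∀ i (v : V), hh i (cls v) = cls ((γ (τ i) * g * (γ i)⁻¹) • v) := fun i v =>
      orbitQuotientEquiv_mk _ (hnorm i) v
    refine ⟨coordPerm τ hh, ⟨τ, hh, fun i => ⟨_, hhm i⟩, coordPerm_apply τ hh⟩, fun v => ?_⟩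
    funext j
    obtain ⟨i, rfl⟩ := τ.surjective j
    rw [coordPerm_apply]
    change cls (γ (τ i) • g • v) = hh i (cls (γ i • v))
    rw [hhm, mul_smul, mul_smul, inv_smul_smul]
  choose ρ₀ hρmem hρblock using hρ
  let ρ : G →* Equiv.Perm (Fin l → Δ) := MonoidHom.mk' ρ₀ fun g g' => by
    ext1 a
    obtain ⟨v, rfl⟩ := block_surj a
    rw [Equiv.Perm.mul_apply, ← hρblock, ← hρblock, ← hρblock, mul_smul]
  have hρ_apply : ∀ g v, ρ g (block v) = block (g • v) := fun g v => (hρblock g v).symm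
  have hρinj : Function.Injective ρ := by
    rw [injective_iff_map_eq_one]
    intro g hg
    by_contra hne
    have hfix : fixedPoints ρ.ker V ≠ Set.univ := by
      intro hf
      apply hne
      refine FaithfulSMul.eq_of_smul_eq_smul (α := V) fun v => ?_
      have hv : v ∈ fixedPoints ρ.ker V := hf ▸ Set.mem_univ v
      rw [one_smul]
      exact hv ⟨g, hg⟩
    -- A nontrivial kernel of ρ would be transitive on V while fixing every block, leaving a single
    -- M-orbit.
    have := h.quasiprimitive.isPretransitive_of_normal hfix
    apply hcls
    intro v w
    obtain ⟨k, hk⟩ := exists_smul_eq ρ.ker ((γ i₀)⁻¹ • v) ((γ i₀)⁻¹ • w)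
    have h1 : block ((γ i₀)⁻¹ • w) = block ((γ i₀)⁻¹ • v) := by
      rw [← hk, Subgroup.smul_def, ← hρ_apply, show ρ k = 1 from k.2]
      rfl
    have h2 := congrFun h1 i₀
    change cls (γ i₀ • (γ i₀)⁻¹ • w) = cls (γ i₀ • (γ i₀)⁻¹ • v) at h2
    rw [smul_inv_smul, smul_inv_smul] at h2
    exact h2.symm
  refine ⟨Δ, actT, ⟨{
    e := e'
    block := block
    block_surjective := block_surj
    ρ := ρ
    ρ_injective := hρinj
    block_smul := fun g v => (hρ_apply g v).symm
    H := inducedPerms G M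
    ρ_mem := hρmem
    mem_H_iff := ?_
    faithful := hfaith
    transitive := htrans
    socle_smul := ?_
    subdirect := ?_ }⟩⟩
  · intro i f
    constructor
    · rintro ⟨x, hx⟩
      refine ⟨(γ i)⁻¹ * x * γ i, fun a => ?_⟩
      obtain ⟨v, rfl⟩ := block_surj a
      rw [hρ_apply]
      change cls (γ i • ((γ i)⁻¹ * x * γ i) • v) = f (cls (γ i • v))
      rw [show f (cls (γ i • v)) = cls (x • γ i • v) from hx _]
      simp only [mul_smul, smul_inv_smul]
    · rintro ⟨g, hg⟩
      refine ⟨γ i * g * (γ i)⁻¹, fun v => ?_⟩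
      have h1 := hg (block ((γ i)⁻¹ • v))
      rw [hρ_apply] at h1
      change cls (γ i • g • (γ i)⁻¹ • v) = f (cls (γ i • (γ i)⁻¹ • v)) at h1
      rw [smul_inv_smul] at h1
      simp only [mul_smul]
      exact h1.symm
  · intro n a i
    obtain ⟨v, rfl⟩ := block_surj a
    rw [hρ_apply, ← block_socle]
    rfl
  · intro α i
    ext t
    rw [mem_stabilizer_iff]
    constructor
    · rintro ⟨n, hn, rfl⟩
      rw [coordHom_apply, ← block_socle, show n • α = α from hn]
    · intro ht
      obtain ⟨n, rfl⟩ := coordHom_surjective e' i t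
      rw [coordHom_apply, ← block_socle] at ht
      -- Undoing γ_i, n • α and α lie in one orbit of the i-th kernel. Correcting n by an element of
      -- that kernel fixes α without changing coordinate i.
      have hm := (orbitMk_smul_eq_iff (hγ i)).1 ht
      obtain ⟨m, hm, hmα⟩ := orbitMk_eq_iff.1 hm.symm
      refine ⟨m * n, ?_, ?_⟩
      · rw [SetLike.mem_coe, mem_stabilizer_iff, mul_smul, hmα]
      · rw [← hγ i] at hm
        rw [map_mul, show coordHom e' i m = 1 from hm, one_mul]

end Existence

/-! ### The bound on the number of simple factors -/

section Bound

open MulAction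

/-- If a subgroup of a vertex-transitive group maps a vertex `α` to each of its neighbours, then
it is transitive. -/
theorem exists_mem_smul_eq_of_neighbors {V N : Type*} [Group N] [MulAction N V]
    {Γ : SimpleGraph V} (hconn : Γ.Connected)
    (hadj : ∀ (n : N) (v w : V), Γ.Adj v w → Γ.Adj (n • v) (n • w)) (X : Subgroup N) (α : V)
    (hX : ∀ β, Γ.Adj α β → ∃ x ∈ X, x • α = β) (v : V) : ∃ x ∈ X, x • α = v := by
  have hreach := (SimpleGraph.reachable_iff_reflTransGen α v).1 (hconn.preconnected α v)
  induction hreach with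
  | refl => exact ⟨1, X.one_mem, one_smul _ _⟩
  | @tail b c _ hbc ih =>
    obtain ⟨x, hx, rfl⟩ := ih
    have h1 := hadj x⁻¹ _ _ hbc
    rw [inv_smul_smul] at h1
    obtain ⟨y, hy, hyc⟩ := hX _ h1
    exact ⟨x * y, X.mul_mem hx hy, by rw [mul_smul, hyc, smul_inv_smul]⟩

variable {G : Type v} [Group G] {V : Type u} [MulAction G V] {T : Type w} [Group T] {l : ℕ}

theorem ProductActionStructure.block_socle_smul {Δ : Type x} [MulAction T Δ]
    (D : ProductActionStructure G V T l Δ) (n : socle G) (v : V) (i : Fin l) :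
    D.block (n • v) i = D.e n i • D.block v i := by
  rw [← D.socle_smul, ← D.block_smul]
  rfl

theorem IsTypePA.le_card_stabilizer [Finite V] {Γ : SimpleGraph V} {d : ℕ}
    (hΓ : InFamily d Γ G) (h : IsTypePA G V T l) {Δ : Type x} [MulAction T Δ]
    (D : ProductActionStructure G V T l Δ) (δ : Δ) :
    l ≤ d ^ d * Nat.card (stabilizer T δ) ^ d := by
  classical
  have := h.simple
  have := h.minimal.1
  have := h.faithful
  have := D.faithful
  have := h.isPretransitive_socle
  have : Finite G := Finite.of_injective (toPermHom G V) (toPerm_injective)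
  let i₀ : Fin l := ⟨0, by have := h.two_le; omega⟩
  have : Finite T := Finite.of_surjective _ (coordHom_surjective D.e i₀)
  obtain ⟨α, hα⟩ := D.block_surjective fun _ => δ
  have hαδ : D.block α i₀ = δ := congrFun hα i₀
  have hadjN : ∀ (n : socle G) (v w : V), Γ.Adj v w → Γ.Adj (n • v) (n • w) := fun n =>
    hΓ.adj_smul n
  have hk : ∀ i, ∃ k : G, k • α = α ∧ ∀ n : socle G,
      D.e (MulAut.conjNormal k n) i₀ = 1 ↔ D.e n i = 1 := by
    intro i
    obtain ⟨g, hg⟩ := h.minimal.exists_comap_conjNormal_eq h.nonabelian D.e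
      (isMaximalNormal_ker D.e i₀) (isMaximalNormal_ker D.e i)
    obtain ⟨m, hm⟩ := exists_smul_eq (socle G) (g • α) α
    -- Multiplying g by m in N brings it into G_α, and conjugation by m preserves the kernels
    -- because they are normal in N.
    refine ⟨m * g, by rw [mul_smul]; exact hm, fun n => ?_⟩
    have hmem : D.e (MulAut.conjNormal g n) i₀ = 1 ↔ D.e n i = 1 :=
      Subgroup.ext_iff.1 hg n
    have hc : MulAut.conjNormal ((m : G) * g) n = m * MulAut.conjNormal g n * m⁻¹ := by
      ext
      simp [MulAut.conjNormal_apply, mul_assoc]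
    rw [← hmem, hc]
    simp
  choose k hkα hker using hk
  have hkS : ∀ i (β : Γ.neighborSet α), k i • (β : V) ∈ Γ.neighborSet α := fun i β => by
    have := hΓ.adj_smul (k i) _ _ β.2
    rwa [hkα] at this
  choose n hn using fun β : V => exists_smul_eq (socle G) α β
  let χ : Fin l → socle G →* T := fun i =>
    (coordHom D.e i₀).comp (MulAut.conjNormal (k i) : socle G ≃* socle G).toMonoidHom
  have hχ : ∀ i m, χ i m = D.e (MulAut.conjNormal (k i) m) i₀ := fun _ _ => rfl
  let F : Fin l → V → Δ := fun i v => D.block (k i • v) i₀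
  have hF : ∀ i (m : socle G) v, F i (m • v) = χ i m • F i v := by
    intro i m v
    rw [hχ, ← D.block_socle_smul, conjNormal_smul_smul]
  have hstab : ∀ i (β : Γ.neighborSet α),
      (D.e (n (k i • (β : V))) i₀)⁻¹ * χ i (n β) ∈ stabilizer T δ := by
    intro i β
    rw [mem_stabilizer_iff, mul_smul, inv_smul_eq_iff]
    have hFα : F i α = δ := by
      change D.block (k i • α) i₀ = δ
      rw [hkα, hαδ]
    have h2 := D.block_socle_smul (n (k i • (β : V))) α i₀
    rw [hn, hαδ] at h2
    rw [← h2, ← hFα, ← hF, hn]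
  let data : Fin l → (Γ.neighborSet α → Γ.neighborSet α) × (Γ.neighborSet α → stabilizer T δ) :=
    fun i => (fun β => ⟨k i • (β : V), hkS i β⟩, fun β => ⟨_, hstab i β⟩)
  have hinj : Function.Injective data := by
    intro i j hij
    by_contra hne
    have h1 : ∀ β : Γ.neighborSet α, k i • (β : V) = k j • (β : V) := fun β =>
      congrArg Subtype.val (congrFun (congrArg Prod.fst hij) β)
    have h2 : ∀ β : Γ.neighborSet α, χ i (n β) = χ j (n β) := by
      intro β
      have := congrArg Subtype.val (congrFun (congrArg Prod.snd hij) β)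
      change (D.e (n (k i • (β : V))) i₀)⁻¹ * χ i (n β)
        = (D.e (n (k j • (β : V))) i₀)⁻¹ * χ j (n β) at this
      rw [h1 β] at this
      exact mul_left_cancel this
    have hFF : ∀ v, F i v = F j v := by
      intro v
      -- The equaliser of χ_i and χ_j contains each n_β, hence is transitive. As F_i and F_j agree
      -- at α, they agree everywhere.
      obtain ⟨m, hm, rfl⟩ := exists_mem_smul_eq_of_neighbors hΓ.connected hadjN
        ((χ i).eqLocus (χ j)) α (fun β hβ => ⟨n β, h2 ⟨β, hβ⟩, hn β⟩) v
      rw [hF, hF, show χ i m = χ j m from hm]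
      congr 1
      change D.block (k i • α) i₀ = D.block (k j • α) i₀
      rw [hkα, hkα]
    obtain ⟨t, ht⟩ := exists_ne (1 : T)
    -- An element of the j-th factor is killed by χ_i but not by χ_j. Since F_i = F_j, its image
    -- under χ_j would nevertheless act trivially on Δ, against faithfulness.
    let m : socle G := D.e.symm (Pi.mulSingle j t)
    have hmi : χ i m = 1 := (hker i m).2 (by
      rw [MulEquiv.apply_symm_apply, Pi.mulSingle_eq_of_ne hne])
    have hmj : χ j m ≠ 1 := fun hh => by
      have := (hker j m).1 hh
      rw [MulEquiv.apply_symm_apply, Pi.mulSingle_eq_same] at this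
      exact ht this
    apply hmj
    refine FaithfulSMul.eq_of_smul_eq_smul (α := Δ) fun p => ?_
    obtain ⟨w, hw⟩ := D.block_surjective fun _ => p
    have hp : F j ((k j)⁻¹ • w) = p := by
      change D.block (k j • (k j)⁻¹ • w) i₀ = p
      rw [smul_inv_smul, hw]
    rw [one_smul, ← hp, ← hF, ← hFF, ← hFF, hF, hmi, one_smul]
  have hS : Nat.card (Γ.neighborSet α) ≤ d := by
    have := hΓ.valency_le α
    rwa [← Set.Finite.cast_ncard_eq (Set.toFinite _), Nat.cast_le] at this
  have hcard := Nat.card_le_card_of_injective data hinj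
  rw [Nat.card_prod, Nat.card_fun, Nat.card_fun, Nat.card_fin] at hcard
  have hpos : 0 < Nat.card (stabilizer T δ) := Nat.card_pos
  have hself : Nat.card (Γ.neighborSet α) ^ Nat.card (Γ.neighborSet α) ≤ d ^ d :=
    Nat.pow_self_mono hS
  exact hcard.trans (Nat.mul_le_mul hself (Nat.pow_le_pow_right hpos hS))

end Bound

/-! ### The main theorem -/

theorem mainTheorem4 {V : Type u} [Finite V] (Γ : SimpleGraph V)
    {G : Type v} [Group G] [MulAction G V] {T : Type w} [Group T] {l : ℕ}
    (d : ℕ) (hd : 0 < d) (hΓ : InFamily d Γ G) (hPA : IsTypePA G V T l) :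
    -- there is a product action structure, so that `Δ` and `T_δ` make sense
    (∃ (Δ : Type u) (_ : MulAction T Δ), Nonempty (ProductActionStructure G V T l Δ)) ∧
    -- the bound on the number of simple factors
    (∀ (Δ : Type x) [MulAction T Δ], ProductActionStructure G V T l Δ →
      ∀ δ : Δ, l ≤ d ^ d * Nat.card (MulAction.stabilizer T δ) ^ (2 * d)) ∧
    -- the socle `N` has maximal normal subgroups `M`, and each of them gives a pair
    -- `(Γ_M, N/M)` in the family, with `N/M ≅ T` and vertex stabilisers conjugate to `T_δ`
    (∃ M : Subgroup (socle G), IsMaximalNormal M) ∧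
    (∀ (M : Subgroup (socle G)) [M.Normal], IsMaximalNormal M →
      ¬ MulAction.IsPretransitive M V ∧
      InFamily d (normalQuotient Γ M) (socle G ⧸ M) ∧
      ∀ (Δ : Type x) [MulAction T Δ] (D : ProductActionStructure G V T l Δ),
        ∃ φ : (socle G ⧸ M) ≃* T,
          (∃ i : Fin l, ∀ n : socle G, φ (QuotientGroup.mk n) = D.e n i) ∧
          ∀ (δ : Δ) (p : MulAction.orbitRel.Quotient M V), ∃ t : T,
            (MulAction.stabilizer (socle G ⧸ M) p).map φ.toMonoidHom
              = (MulAction.stabilizer T δ).map (MulAut.conj t).toMonoidHom) ∧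
    -- up to isomorphism the pair depends only on `(Γ, G)`, not on the choice of `M`
    (∀ (M M' : Subgroup (socle G)) [M.Normal] [M'.Normal],
      IsMaximalNormal M → IsMaximalNormal M' →
      PairIso (normalQuotient Γ M) (socle G ⧸ M) (normalQuotient Γ M') (socle G ⧸ M')) := by
  have := hPA.minimal.1
  have := hPA.simple
  have := hPA.isPretransitive_socle
  have := hΓ.connected.nonempty
  obtain ⟨e, -⟩ := hPA.proj_ne_top
  refine ⟨hPA.exists_productActionStructure, ?_, ?_, ?_, ?_⟩
  · intro Δ _ D δ
    have := hPA.faithful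
    have : Finite G := Finite.of_injective (MulAction.toPermHom G V) MulAction.toPerm_injective
    have : Finite T := Finite.of_surjective _
      (coordHom_surjective D.e ⟨0, lt_of_lt_of_le two_pos hPA.two_le⟩)
    -- The counting argument gives exponent d, which is weakened here to 2d.
    refine (hPA.le_card_stabilizer hΓ D δ).trans (Nat.mul_le_mul_left _ ?_)
    exact Nat.pow_le_pow_right Nat.card_pos (Nat.le_mul_of_pos_left d two_pos)
  · exact ⟨_, isMaximalNormal_ker e ⟨0, lt_of_lt_of_le two_pos hPA.two_le⟩⟩
  · intro M _ hM
    have hintrans := hPA.not_isPretransitive hM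
    refine ⟨hintrans, inFamily_normalQuotient hΓ.connected hΓ.valency_le
      (fun (n : socle G) => hΓ.adj_smul n) M (hM.faithfulSMul_orbits hintrans), fun Δ _ D => ?_⟩
    obtain ⟨i, hi⟩ := hM.exists_eq_ker hPA.nonabelian D.e
    obtain ⟨φ, hφ, hstab⟩ := D.exists_quotient_equiv M i hi
    exact ⟨φ, ⟨i, hφ⟩, hstab⟩
  · intro M M' _ _ hM hM'
    obtain ⟨g, hg⟩ := hPA.minimal.exists_comap_conjNormal_eq hPA.nonabelian e hM' hM
    exact pairIso_of_comap_conjNormal_eq hΓ.adj_smul g hg
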